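/- Let $u>0$, $T=[0,u]$, let $\lambda$ be Lebesgue measure on $T$, and let $E=C_0(T;\mathbb R)$ be the space of continuous functions $x\colon T\to\mathbb R$ with $x(0)=0$, with the supremum norm $\|\cdot\|_\infty$. Let $H$ be the Cameron--Martin space of one-dimensional standard Brownian motion on $T$, i.e. the space of all $h\in E$ of the form $$h(t)=\int_0^t f_h\,d\lambda,\qquad t\in T,\quad\text{with } f_h\in L^2(\lambda),\qquad \|h\|_H:=\|f_h\|_{L^2(\lambda)}.$$ ($f_h$ is uniquely determined by $h$.) For a set $D$ of functions on $T$ let $H(D)$ be the set of all $h\in H$ such that $f_h$ is $\lambda$-a.e. equal to an element of $D$, and let $H_{\mathrm{bv}}$ be the set of all $h\in H$ such that $f_h$ is $\lambda$-a.e. equal to a function of bounded variation on $T$. Let $F\colon E\to[0,\infty)$ be continuous, put $\tilde F=\log F\colon E\to\mathbb R\cup\{-\infty\}$ (with $\log 0=-\infty$), and assume that there are $K_1,K_2>0$ and $\alpha\in(0,2)$ with $\tilde F(x)\le K_1+K_2\|x\|_\infty^{\alpha}$ for all $x\in E$. For $M>0$ and $h\in H$ define $$\tilde F_{h,M}\colon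 H\to\mathbb R\cup\{-\infty\},\qquad \tilde F_{h,M}(g)=2\tilde F(g)-M\|g+h\|_H^2+\|h\|_H^2 .$$ Let $\psi\colon\mathbb R\to\mathbb R$ be continuously differentiable, bounded and non-constant, and let $$D=\mathcal{NN}^1_{1,\infty}(\psi)=\operatorname{span}\{T\ni t\mapsto\psi(at+b) : a,b\in\mathbb R\}$$ be the set of shallow feedforward neural networks on $T$ with activation function $\psi$. Then $H(D)\subset H_{\mathrm{bv}}$. Moreover, for all $M>0$ and $h\in H$, the functional $\tilde F_{h,M}$ attains its maximum over $H$, and for every maximizer $g_{h,M}\in H$ there exists a sequence $(h_n)_{n\in\mathbb N}$ in $H(D)$ such that $$\lim_{n\to\infty}\tilde F_{h,M}(h_n)=\tilde F_{h,M}(g_{h,M})=\max_{g\in H}\bigl(2\tilde F(g)-M\|g+h\|_H^2+\|h\|_H^2\bigr),$$ with the limit taken in $[-\infty,\infty]$. -/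

import Mathlib

open MeasureTheory Set Filter Topology

namespace CameronMartin

/-- The time interval `T = [0, u]`. -/
abbrev Time (u : ℝ) : Type := Set.Icc (0 : ℝ) u

/-- Lebesgue measure `λ` on `[0, u]`. -/
noncomputable def leb (u : ℝ) : Measure (Time u) := volume.comap Subtype.val

instance isFiniteMeasure_leb (u : ℝ) : IsFiniteMeasure (leb u) := by
  refine ⟨?_⟩
  rw [leb, comap_subtype_coe_apply measurableSet_Icc]
  exact lt_of_le_of_lt (measure_mono (Subtype.coe_image_subset _ _)) measure_Icc_lt_top

instance nullSingletonClass_leb (u : ℝ) : NullSingletonClass (leb u) := by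
  refine ⟨fun t => ?_⟩
  rw [leb, comap_subtype_coe_apply measurableSet_Icc]
  simp

/-- `C₀(T; ℝ)`: continuous real functions on `[0, u]` vanishing at the origin, with the
supremum norm (inherited from `C([0, u], ℝ)`). -/
def PathSpace (u : ℝ) : Submodule ℝ C(Time u, ℝ) where
  carrier := {x | ∀ t : Time u, (t : ℝ) = 0 → x t = 0}
  add_mem' := by
    intro x y hx hy t ht
    simp [hx t ht, hy t ht]
  zero_mem' := by
    intro t _
    rfl
  smul_mem' := by
    intro c x hx t ht
    simp [hx t ht]

/-- `Λ² = L²(λ)`, where `λ` is Lebesgue measure on `[0, u]`. -/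
abbrev Lambda2 (u : ℝ) : Type := Lp ℝ 2 (leb u)

theorem integrable_lambda2 {u : ℝ} (f : Lambda2 u) : Integrable f (leb u) :=
  (Lp.memLp f).integrable (by norm_num)

theorem continuous_primitive {u : ℝ} (f : Lambda2 u) :
    Continuous fun t : Time u => ∫ s in Set.Iic t, f s ∂leb u := by
  have h : (fun t : Time u => ∫ s in Set.Iic t, f s ∂leb u)
      = fun t : Time u => ∫ s, (Set.Iic t).indicator f s ∂leb u := by
    funext t
    rw [integral_indicator measurableSet_Iic]
  rw [h, continuous_iff_continuousAt]
  intro t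
  refine continuousAt_of_dominated (bound := fun s => ‖f s‖) ?_ ?_
    (integrable_lambda2 f).norm ?_
  · exact Eventually.of_forall fun t' =>
      (integrable_lambda2 f).aestronglyMeasurable.indicator measurableSet_Iic
  · exact Eventually.of_forall fun t' => Eventually.of_forall fun s =>
      norm_indicator_le_norm_self _ _
  · have hne : ∀ᵐ s ∂leb u, s ≠ t := by
      simp [ae_iff]
    filter_upwards [hne] with s hs
    rcases lt_or_gt_of_ne hs with hlt | hgt
    · refine (continuousAt_const (y := f s)).congr ?_
      filter_upwards [lt_mem_nhds hlt] with t' ht'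
      simp [Set.indicator, le_of_lt ht']
    · refine (continuousAt_const (y := (0 : ℝ))).congr ?_
      filter_upwards [gt_mem_nhds hgt] with t' ht'
      simp [Set.indicator, not_le.mpr ht']

theorem primitive_zero {u : ℝ} (f : Lambda2 u) (t : Time u) (ht : (t : ℝ) = 0) :
    ∫ s in Set.Iic t, f s ∂leb u = 0 := by
  have h : Set.Iic t = {t} := by
    ext s
    constructor
    · intro hs
      have h1 : (s : ℝ) ≤ t := hs
      exact Subtype.ext (le_antisymm h1 (by rw [ht]; exact s.2.1))
    · rintro rfl
      exact Set.mem_Iic.2 (le_refl _)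
  rw [h]
  simp

/-- `J f (t) = ∫_{[0, t]} f dλ`, as a linear map from `Λ²` to `C₀(T; ℝ)`. -/
noncomputable def J (u : ℝ) : Lambda2 u →ₗ[ℝ] PathSpace u where
  toFun f := ⟨⟨fun t => ∫ s in Set.Iic t, f s ∂leb u, continuous_primitive f⟩, primitive_zero f⟩
  map_add' f g := by
    ext t
    change ∫ s in Set.Iic t, (f + g : Lambda2 u) s ∂leb u
      = (∫ s in Set.Iic t, f s ∂leb u) + ∫ s in Set.Iic t, g s ∂leb u
    rw [← integral_add (integrable_lambda2 f).integrableOn (integrable_lambda2 g).integrableOn]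
    exact integral_congr_ae (ae_restrict_of_ae (Lp.coeFn_add f g))
  map_smul' c f := by
    ext t
    change ∫ s in Set.Iic t, (c • f : Lambda2 u) s ∂leb u = c * ∫ s in Set.Iic t, f s ∂leb u
    rw [← integral_const_mul]
    exact integral_congr_ae (ae_restrict_of_ae (Lp.coeFn_smul c f))

theorem J_apply {u : ℝ} (f : Lambda2 u) (t : Time u) :
    (J u f : C(Time u, ℝ)) t = ∫ s in Set.Iic t, f s ∂leb u := rfl

theorem J_injective (u : ℝ) : Function.Injective (J u) := by
  rw [injective_iff_map_eq_zero]
  intro f hf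
  have h0 : ∀ t : Time u, ∫ s in Set.Iic t, f s ∂leb u = 0 := by
    intro t
    rw [← J_apply, hf]
    rfl
  have hint := integrable_lambda2 f
  have huniv : ∫ s, f s ∂leb u = 0 := by
    rcases lt_or_ge u 0 with hu | hu
    · have : IsEmpty (Time u) := ⟨fun t => absurd (t.2.1.trans t.2.2) (not_le.mpr hu)⟩
      simp [Measure.eq_zero_of_isEmpty (leb u)]
    · have h := h0 ⟨u, hu, le_refl u⟩
      have hI : Set.Iic (⟨u, hu, le_refl u⟩ : Time u) = Set.univ :=
        Set.eq_univ_of_forall fun s => s.2.2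
      rwa [hI, setIntegral_univ] at h
  have hall : ∀ A : Set (Time u), MeasurableSet A → ∫ s in A, f s ∂leb u = 0 := by
    intro A hA
    induction A, hA using MeasurableSpace.induction_on_inter
      (borel_eq_generateFrom_Iic (Time u) ▸ BorelSpace.measurable_eq (α := Time u))
      isPiSystem_Iic with
    | empty => simp
    | basic A hA =>
      obtain ⟨t, rfl⟩ := hA
      exact h0 t
    | compl A hA ih =>
      have h := integral_add_compl hA hint
      linarith
    | iUnion A hd hm ih =>
      rw [integral_iUnion hm hd hint.integrableOn]
      simp [ih]
  have hz : f =ᵐ[leb u] 0 :=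
    hint.ae_eq_zero_of_forall_setIntegral_eq_zero fun s hs _ => hall s hs
  exact (Lp.eq_zero_iff_ae_eq_zero).2 hz

/-- The Cameron--Martin space `H = J(Λ²)` of standard Brownian motion on `[0, u]`, as a linear
subspace of `C₀(T; ℝ)`. -/
noncomputable def H (u : ℝ) : Submodule ℝ (PathSpace u) := LinearMap.range (J u)

/-- The density `f_h ∈ Λ²` of `h ∈ H`, i.e. the unique element of `Λ²` with `J f_h = h`. -/
noncomputable def density {u : ℝ} (h : H u) : Lambda2 u :=
  (LinearEquiv.ofInjective (J u) (J_injective u)).symm h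

theorem J_density {u : ℝ} (h : H u) : J u (density h) = h :=
  congrArg Subtype.val ((LinearEquiv.ofInjective (J u) (J_injective u)).apply_symm_apply h)

/-- `‖h‖_H = ‖f_h‖_{Λ²}`. -/
noncomputable def normH {u : ℝ} (h : H u) : ℝ := ‖density h‖

/-- `H(D)`: all `h ∈ H` whose density is (the class of) a function in `D`. -/
def HOf {u : ℝ} (D : Set (Time u → ℝ)) : Set (H u) :=
  {h | ∃ φ ∈ D, (density h : Time u → ℝ) =ᵐ[leb u] φ}

/-- `H_bv`: all `h ∈ H` whose density is (the class of) a function of bounded variation. -/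
def Hbv (u : ℝ) : Set (H u) :=
  HOf {φ : Time u → ℝ | BoundedVariationOn φ Set.univ}

/-- Shallow feedforward networks on `[0, u]` with one input neuron, one output neuron, and
arbitrarily many hidden nodes with activation `ψ`: the linear span of the functions
`t ↦ ψ (α t + η)`. -/
def NN (u : ℝ) (ψ : ℝ → ℝ) : Submodule ℝ (Time u → ℝ) :=
  Submodule.span ℝ {φ | ∃ α η : ℝ, φ = fun t : Time u => ψ (α * (t : ℝ) + η)}

/-- `F̃ = log F` with values in `ℝ ∪ {-∞}`, where `log 0 = -∞`. -/
noncomputable def logPayoff {u : ℝ} (F : PathSpace u → NNReal) (x : PathSpace u) : EReal :=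
  ENNReal.log (F x : ENNReal)

/-- `F̃_{h,M}(g) = 2 F̃(g) - M ‖g + h‖_H² + ‖h‖_H²` for `g ∈ H`. -/
noncomputable def driftFunctional {u : ℝ} (F : PathSpace u → NNReal) (M : ℝ) (h g : H u) :
    EReal :=
  2 * logPayoff F (g : PathSpace u) - ((M * normH (g + h) ^ 2 : ℝ) : EReal)
    + ((normH h ^ 2 : ℝ) : EReal)

end CameronMartin

/-! Parametrize by the density `f` of `g + h`: the functional becomes the extended logarithm of
`expDrift`, a nonnegative norm-continuous function on `Λ²`, which avoids arithmetic with `-∞`.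

Existence of a maximizer is the direct method. Growth of order `α < 2` loses against the quadratic
penalty, so competitors lie in a ball (`expDrift_coercive`). On balls `J` is continuous from the
weak topology to the supremum norm, but the norm is only weakly lower semicontinuous. It is
therefore replaced by an independent bound `s ≥ ‖f‖`: the relaxed functional is continuous on the
compact set `normBoundPairs`, and putting `s = ‖f‖` afterwards can only increase it.

Approximation needs networks to be dense in `Λ²`. If `f` is orthogonal to every `ψ(at + b)`, then
also to the ridge functions of a non-constant mollification `g` of `ψ`. Differentiating `k` times in
`a` at `a = 0` gives `g⁽ᵏ⁾(b) ∫ f tᵏ = 0`. A bounded non-constant smooth function is not a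
polynomial, so some `g⁽ᵏ⁾(b) ≠ 0`; all moments of `f` vanish and `f = 0` by Weierstrass.

Networks are Lipschitz on `[0, u]`, hence of bounded variation. -/

namespace Polynomial

/-! ### Smooth functions with a vanishing higher derivative -/

theorem exists_derivative_eq (P : Polynomial ℝ) : ∃ Q : Polynomial ℝ, derivative Q = P := by
  induction P using Polynomial.induction_on' with
  | add p q hp hq =>
    obtain ⟨P, rfl⟩ := hp
    obtain ⟨Q, rfl⟩ := hq
    exact ⟨P + Q, derivative_add⟩
  | monomial n a =>
    refine ⟨monomial (n + 1) (a / (n + 1)), ?_⟩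
    have : (n : ℝ) + 1 ≠ 0 := by positivity
    rw [derivative_monomial]
    simp [this]

end Polynomial

theorem exists_polynomial_of_iteratedDeriv_eq_zero (k : ℕ) :
    ∀ g : ℝ → ℝ, ContDiff ℝ ((⊤ : ℕ∞) : WithTop ℕ∞) g → (∀ x, iteratedDeriv k g x = 0) →
      ∃ P : Polynomial ℝ, ∀ x, g x = P.eval x := by
  induction k with
  | zero => exact fun g _ h0 => ⟨0, fun x => by simpa using h0 x⟩
  | succ k ih =>
    intro g hg h0
    obtain ⟨P, hP⟩ := ih (deriv g) (contDiff_infty_iff_deriv.1 hg).2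
      (fun x => by rw [← iteratedDeriv_succ']; exact h0 x)
    obtain ⟨Q, rfl⟩ := P.exists_derivative_eq
    have hdiff : Differentiable ℝ g := hg.differentiable (by simp)
    have hc := is_const_of_deriv_eq_zero (f := fun x => g x - Q.eval x)
      (hdiff.sub Q.differentiable) (fun x => by
        rw [deriv_fun_sub (hdiff x) Q.differentiableAt, hP, Polynomial.deriv, sub_self])
    refine ⟨Q + Polynomial.C (g 0 - Q.eval 0), fun x => ?_⟩
    have := hc x 0
    simp only [Polynomial.eval_add, Polynomial.eval_C]
    linarith

/-- Otherwise `g` would be a polynomial, and a bounded polynomial is constant. -/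
theorem exists_iteratedDeriv_ne_zero {g : ℝ → ℝ} (hg : ContDiff ℝ ((⊤ : ℕ∞) : WithTop ℕ∞) g)
    (hb : ∃ C, ∀ x, |g x| ≤ C) (hnc : ¬ ∃ c, ∀ x, g x = c) (k : ℕ) :
    ∃ x, iteratedDeriv k g x ≠ 0 := by
  by_contra! h0
  obtain ⟨P, hP⟩ := exists_polynomial_of_iteratedDeriv_eq_zero k g hg h0
  obtain ⟨C, hC⟩ := hb
  have hdeg : P.degree ≤ 0 := P.isBoundedUnder_abs_atTop_iff.1
    (isBoundedUnder_of ⟨C, fun x => (congrArg abs (hP x)).symm.trans_le (hC x)⟩)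
  refine hnc ⟨P.coeff 0, fun x => ?_⟩
  rw [hP, Polynomial.eq_C_of_degree_le_zero hdeg]
  simp

/-! ### Mollified ridge functions and moments -/

/-- A bounded continuous non-constant function has a non-constant mollification. -/
theorem exists_bump_convolution_nonconst {ψ : ℝ → ℝ} (hψ : Continuous ψ)
    (hnc : ¬ ∃ c, ∀ x, ψ x = c) :
    ∃ φ : ContDiffBump (0 : ℝ), ¬ ∃ c, ∀ x,
      (convolution (φ.normed volume) ψ (ContinuousLinearMap.lsmul ℝ ℝ) volume) x = c := by
  by_contra! h
  let φ : ℕ → ContDiffBump (0 : ℝ) := fun n =>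
    ⟨1 / ((n : ℝ) + 1) / 2, 1 / ((n : ℝ) + 1), by positivity,
      half_lt_self (by positivity)⟩
  have hφ : Tendsto (fun n => (φ n).rOut) atTop (𝓝 0) := tendsto_one_div_add_atTop_nhds_zero_nat
  choose c hc using h
  refine hnc ⟨ψ 0, fun x => ?_⟩
  -- Constant mollifications have the same values at `x` and at `0`, so their pointwise limits `ψ x`
  -- and `ψ 0` agree.
  refine tendsto_nhds_unique (ContDiffBump.convolution_tendsto_right_of_continuous
    (μ := volume) hφ hψ x) ?_
  refine (ContDiffBump.convolution_tendsto_right_of_continuous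
    (μ := volume) hφ hψ 0).congr fun n => ?_
  rw [hc, hc]

theorem abs_bump_convolution_le {ψ : ℝ → ℝ} {C : ℝ} (hC : ∀ x, |ψ x| ≤ C)
    (φ : ContDiffBump (0 : ℝ)) (x : ℝ) :
    |(convolution (φ.normed volume) ψ (ContinuousLinearMap.lsmul ℝ ℝ) volume) x| ≤ C := by
  rw [convolution_def, ← Real.norm_eq_abs]
  calc _ ≤ ∫ t, φ.normed volume t * C := by
        refine norm_integral_le_of_norm_le (φ.integrable_normed.mul_const C)
          (Eventually.of_forall fun t => ?_)
        simp only [ContinuousLinearMap.lsmul_apply, smul_eq_mul, norm_mul, Real.norm_eq_abs]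
        rw [abs_of_nonneg (φ.nonneg_normed t)]
        exact mul_le_mul_of_nonneg_left (hC _) (φ.nonneg_normed t)
    _ = C := by rw [integral_mul_const, φ.integral_normed, one_mul]

/-- If `f` annihilates all ridge functions of a bounded continuous `ψ`, then it annihilates all
ridge functions of a mollification of `ψ`. -/
theorem integral_mul_bump_convolution_eq_zero {X : Type*} [MeasurableSpace X] {μ : Measure X}
    [SFinite μ] {τ : X → ℝ} (hτ : Measurable τ) {f : X → ℝ} (hf : Integrable f μ)
    {ψ : ℝ → ℝ} (hψ : Continuous ψ) {C : ℝ} (hC : ∀ x, |ψ x| ≤ C)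
    (h0 : ∀ a b : ℝ, ∫ t, f t * ψ (a * τ t + b) ∂μ = 0) (φ : ContDiffBump (0 : ℝ)) (a b : ℝ) :
    ∫ t, f t * (convolution (φ.normed volume) ψ (ContinuousLinearMap.lsmul ℝ ℝ) volume)
      (a * τ t + b) ∂μ = 0 := by
  have hint : Integrable (fun p : X × ℝ =>
      (f p.1 * φ.normed volume p.2) * ψ (a * τ p.1 + b - p.2)) (μ.prod volume) := by
    refine (hf.mul_prod (φ.integrable_normed (μ := volume))).mul_bdd (c := C) ?_
      (Eventually.of_forall fun p => hC _)
    refine (hψ.measurable.comp ?_).aestronglyMeasurable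
    fun_prop
  calc _ = ∫ t, ∫ s, (f t * φ.normed volume s) * ψ (a * τ t + b - s) ∂volume ∂μ := by
        congr 1 with t
        rw [convolution_def, ← integral_const_mul]
        simp [mul_assoc]
    _ = ∫ s, ∫ t, (f t * φ.normed volume s) * ψ (a * τ t + b - s) ∂μ ∂volume :=
        integral_integral_swap hint
    _ = ∫ s, φ.normed volume s * ∫ t, f t * ψ (a * τ t + (b - s)) ∂μ ∂volume := by
        congr 1 with s
        rw [← integral_const_mul]
        congr 1 with t
        rw [add_sub_assoc]
        ring
    _ = 0 := by simp [h0]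

/-- Differentiating the annihilation relation `k` times in the slope. -/
theorem integral_mul_pow_mul_iteratedDeriv_eq_zero {X : Type*} [MeasurableSpace X]
    {μ : Measure X} {τ : X → ℝ} (hτ : Measurable τ) {r : ℝ} (hr : ∀ t, |τ t| ≤ r)
    {f : X → ℝ} (hf : Integrable f μ) {g : ℝ → ℝ}
    (hg : ContDiff ℝ ((⊤ : ℕ∞) : WithTop ℕ∞) g)
    (h0 : ∀ a b : ℝ, ∫ t, f t * g (a * τ t + b) ∂μ = 0) (k : ℕ) :
    ∀ a b : ℝ, ∫ t, f t * (τ t ^ k * iteratedDeriv k g (a * τ t + b)) ∂μ = 0 := by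
  induction k with
  | zero => simpa using h0
  | succ k ih =>
    intro a b
    have hcont : ∀ j, Continuous (iteratedDeriv j g) := fun j =>
      hg.continuous_iteratedDeriv j (by exact_mod_cast le_top)
    have hdiff : Differentiable ℝ (iteratedDeriv k g) :=
      hg.differentiable_iteratedDeriv k (by exact_mod_cast WithTop.coe_lt_top k)
    -- For slopes within `1` of `a` the argument `x * τ t + b` stays in a fixed compact interval,
    -- because `τ` is bounded; this gives the domination for differentiating under the integral.
    have hbdd : ∀ j, ∃ B, ∀ x ∈ Metric.ball a 1, ∀ t,
        ‖τ t ^ j * iteratedDeriv j g (x * τ t + b)‖ ≤ B := by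
      intro j
      obtain ⟨B, hB⟩ := (isCompact_Icc (a := -((|a| + 1) * r + |b|))
        (b := (|a| + 1) * r + |b|)).exists_bound_of_continuousOn (hcont j).continuousOn
      refine ⟨r ^ j * B, fun x hx t => ?_⟩
      have hx' : |x| ≤ |a| + 1 := by
        have h1 : |x - a| < 1 := by simpa [Real.dist_eq] using hx
        have h2 := abs_add_le (x - a) a
        rw [sub_add_cancel] at h2
        linarith
      have hmem : |x * τ t + b| ≤ (|a| + 1) * r + |b| := by
        refine (abs_add_le _ _).trans ?_
        rw [abs_mul]
        gcongr
        exact hr t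
      rw [norm_mul, norm_pow, Real.norm_eq_abs (τ t)]
      exact mul_le_mul (pow_le_pow_left₀ (abs_nonneg _) (hr t) j) (hB _ (abs_le.1 hmem))
        (norm_nonneg _) (pow_nonneg ((abs_nonneg _).trans (hr t)) j)
    have hmeas : ∀ j x, AEStronglyMeasurable
        (fun t => τ t ^ j * iteratedDeriv j g (x * τ t + b)) μ := fun j x =>
      ((hτ.pow_const j).mul ((hcont j).measurable.comp
        ((hτ.const_mul x).add_const b))).aestronglyMeasurable
    obtain ⟨B, hB⟩ := hbdd (k + 1)
    obtain ⟨B', hB'⟩ := hbdd k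
    have key := hasDerivAt_integral_of_dominated_loc_of_deriv_le (μ := μ)
      (F := fun x t => f t * (τ t ^ k * iteratedDeriv k g (x * τ t + b)))
      (F' := fun x t => f t * (τ t ^ (k + 1) * iteratedDeriv (k + 1) g (x * τ t + b)))
      (bound := fun t => ‖f t‖ * B) (Metric.ball_mem_nhds a one_pos)
      (Eventually.of_forall fun x => hf.aestronglyMeasurable.mul (hmeas k x))
      (hf.mul_bdd (c := B') (hmeas k a) (Eventually.of_forall fun t =>
        hB' a (Metric.mem_ball_self one_pos) t))
      (hf.aestronglyMeasurable.mul (hmeas (k + 1) a))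
      (Eventually.of_forall fun t x hx => by
        rw [norm_mul]
        exact mul_le_mul_of_nonneg_left (hB x hx t) (norm_nonneg _))
      (hf.norm.mul_const B)
      (Eventually.of_forall fun t x _ => by
        have h1 : HasDerivAt (fun x : ℝ => x * τ t + b) (τ t) x := by
          simpa using ((hasDerivAt_id x).mul_const (τ t)).add_const b
        have h2 := (hdiff (x * τ t + b)).hasDerivAt.comp x h1
        rw [← iteratedDeriv_succ] at h2
        refine ((h2.const_mul (τ t ^ k)).const_mul (f t)).congr_deriv ?_
        ring)
    have h2 := key.2
    simp only [ih] at h2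
    exact h2.unique (hasDerivAt_const a 0)

theorem integral_mul_pow_eq_zero_of_ridge {X : Type*} [MeasurableSpace X]
    {μ : Measure X} [SFinite μ] {τ : X → ℝ} (hτ : Measurable τ) {r : ℝ} (hr : ∀ t, |τ t| ≤ r)
    {f : X → ℝ} (hf : Integrable f μ) {ψ : ℝ → ℝ} (hψ : Continuous ψ)
    (hb : ∃ C, ∀ x, |ψ x| ≤ C) (hnc : ¬ ∃ c, ∀ x, ψ x = c)
    (h0 : ∀ a b : ℝ, ∫ t, f t * ψ (a * τ t + b) ∂μ = 0) (k : ℕ) :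
    ∫ t, f t * τ t ^ k ∂μ = 0 := by
  obtain ⟨C, hC⟩ := hb
  obtain ⟨φ, hφ⟩ := exists_bump_convolution_nonconst hψ hnc
  have hg := φ.hasCompactSupport_normed.contDiff_convolution_left (n := ⊤)
    (ContinuousLinearMap.lsmul ℝ ℝ) (φ.contDiff_normed (μ := volume))
    (hψ.locallyIntegrable (μ := volume))
  obtain ⟨b, hb⟩ := exists_iteratedDeriv_ne_zero hg ⟨C, abs_bump_convolution_le hC φ⟩ hφ k
  -- At slope `0` the derivative factor is the nonzero constant `iteratedDeriv k g b` and leaves the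
  -- integral.
  have h := integral_mul_pow_mul_iteratedDeriv_eq_zero hτ hr hf hg
    (integral_mul_bump_convolution_eq_zero hτ hf hψ hC h0 φ) k 0 b
  simp only [zero_mul, zero_add, ← mul_assoc, integral_mul_const] at h
  exact (mul_eq_zero.1 h).resolve_right hb

/-! ### Networks have bounded variation -/

namespace CameronMartin

theorem exists_lipschitzWith_of_mem_NN {u : ℝ} {ψ : ℝ → ℝ} (hψ : ContDiff ℝ 1 ψ)
    {φ : Time u → ℝ} (hφ : φ ∈ NN u ψ) : ∃ C : NNReal, LipschitzWith C φ := by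
  induction hφ using Submodule.span_induction with
  | mem φ hφ =>
    obtain ⟨a, b, rfl⟩ := hφ
    have hc : ContDiff ℝ 1 fun t : ℝ => ψ (a * t + b) :=
      hψ.comp ((contDiff_const.mul contDiff_id).add contDiff_const)
    obtain ⟨C, hC⟩ := hc.contDiffOn.exists_lipschitzOnWith one_ne_zero
      (convex_Icc (0 : ℝ) u) isCompact_Icc
    exact ⟨C, hC.to_restrict⟩
  | zero => exact ⟨0, LipschitzWith.const 0⟩
  | add x y _ _ hx hy =>
    obtain ⟨A, hA⟩ := hx
    obtain ⟨B, hB⟩ := hy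
    exact ⟨A + B, hA.add hB⟩
  | smul c x _ hx =>
    obtain ⟨A, hA⟩ := hx
    exact ⟨‖c‖₊ * A, (lipschitzWith_smul c).comp hA⟩

theorem boundedVariationOn_of_lipschitzWith {u : ℝ} {φ : Time u → ℝ} {C : NNReal}
    (hφ : LipschitzWith C φ) : BoundedVariationOn φ univ := by
  have hmono : BoundedVariationOn (Subtype.val : Time u → ℝ) univ :=
    MonotoneOn.boundedVariationOn (C := u) (fun x _ y _ h => h)
      (fun x _ => by rw [abs_of_nonneg x.2.1]; exact x.2.2)
  -- Distances in the subtype are those of `ℝ`, so the two variations agree definitionally.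
  have hid : BoundedVariationOn (id : Time u → Time u) univ := hmono
  exact hφ.comp_boundedVariationOn hid

theorem HOf_NN_subset_Hbv {u : ℝ} {ψ : ℝ → ℝ} (hψ : ContDiff ℝ 1 ψ) :
    HOf (NN u ψ : Set (Time u → ℝ)) ⊆ Hbv u := by
  rintro h ⟨φ, hφ, hae⟩
  obtain ⟨C, hC⟩ := exists_lipschitzWith_of_mem_NN hψ hφ
  exact ⟨φ, boundedVariationOn_of_lipschitzWith hC, hae⟩

/-! ### Continuity of the primitive operator -/

/-- The point of `H` with a given density. -/
noncomputable def ofDensity {u : ℝ} (f : Lambda2 u) : H u :=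
  LinearEquiv.ofInjective (J u) (J_injective u) f

theorem density_ofDensity {u : ℝ} (f : Lambda2 u) : density (ofDensity f) = f :=
  (LinearEquiv.ofInjective (J u) (J_injective u)).symm_apply_apply f

theorem density_add {u : ℝ} (g h : H u) : density (g + h) = density g + density h :=
  map_add (LinearEquiv.ofInjective (J u) (J_injective u)).symm g h

/-- The indicator of `[0, t]` as an element of `Λ²`. -/
noncomputable def initialIndicator {u : ℝ} (t : Time u) : Lambda2 u :=
  indicatorConstLp 2 (measurableSet_Iic (a := t)) (measure_ne_top (leb u) _) (1 : ℝ)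

/-- Evaluating a primitive at `t` is pairing its density with a fixed vector, hence weakly
continuous. -/
theorem inner_initialIndicator {u : ℝ} (t : Time u) (f : Lambda2 u) :
    inner ℝ (initialIndicator t) f = (J u f : C(Time u, ℝ)) t := by
  rw [J_apply]
  exact L2.inner_indicatorConstLp_one _ _ f

/-- The symmetric difference of `[0, s]` and `[0, t]` is an interval of length `|s - t|`. -/
theorem continuous_initialIndicator (u : ℝ) :
    Continuous (initialIndicator : Time u → Lambda2 u) := by
  refine continuous_indicatorConstLp_set (by simp) fun t => ?_
  have hcont : ContinuousAt (fun s : Time u => leb u (uIoc t s)) t := by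
    have hle : ∀ s : Time u, leb u (uIoc t s) ≤ ENNReal.ofReal (dist s t) := by
      intro s
      rw [leb, comap_subtype_coe_apply measurableSet_Icc]
      calc volume (Subtype.val '' uIoc t s) ≤ volume (uIoc (t : ℝ) (s : ℝ)) := by
            refine measure_mono ?_
            rintro _ ⟨x, hx, rfl⟩
            simp only [mem_uIoc] at hx ⊢
            exact hx
        _ = ENNReal.ofReal (dist s t) := by
            rw [Real.volume_uIoc, Subtype.dist_eq, Real.dist_eq]
    have h0 : leb u (uIoc t t) = 0 := by simp
    rw [ContinuousAt, h0]
    refine tendsto_of_tendsto_of_tendsto_of_le_of_le tendsto_const_nhds ?_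
      (fun s => zero_le) hle
    have : Tendsto (fun s : Time u => dist s t) (𝓝 t) (𝓝 0) := tendsto_iff_dist_tendsto_zero.1
      tendsto_id
    simpa using ENNReal.tendsto_ofReal this
  have h0 : leb u (uIoc t t) = 0 := by simp
  rw [ContinuousAt, h0] at hcont
  refine hcont.congr fun s => congrArg _ ?_
  ext x
  simp only [mem_uIoc, mem_symmDiff, mem_Iic]
  grind

theorem norm_initialIndicator_le {u : ℝ} (t : Time u) :
    ‖initialIndicator t‖ ≤ √((leb u).real univ) := by
  refine norm_indicatorConstLp_le.trans ?_
  rw [norm_one, one_mul, Real.sqrt_eq_rpow, ENNReal.toReal_ofNat]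
  exact Real.rpow_le_rpow measureReal_nonneg (measureReal_mono (subset_univ _)) (by norm_num)

theorem norm_J_le {u : ℝ} (f : Lambda2 u) : ‖J u f‖ ≤ √((leb u).real univ) * ‖f‖ := by
  change ‖(J u f : C(Time u, ℝ))‖ ≤ _
  refine (ContinuousMap.norm_le _ (by positivity)).2 fun t => ?_
  rw [← inner_initialIndicator]
  exact (norm_inner_le_norm _ _).trans
    (mul_le_mul_of_nonneg_right (norm_initialIndicator_le t) (norm_nonneg _))

theorem continuous_J (u : ℝ) : Continuous (J u) :=
  ((J u).mkContinuous _ norm_J_le).continuous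

/-! ### The exponentiated functional and its coercivity -/

/-- The payoff `exp F̃_{h,M}` with values in `[0, ∞)`, as a function of the density of `g + h`. -/
noncomputable def expDrift {u : ℝ} (F : PathSpace u → NNReal) (M : ℝ) (h : H u) (f : Lambda2 u) :
    ℝ :=
  (F (J u f - h) : ℝ) ^ 2 * Real.exp (normH h ^ 2 - M * ‖f‖ ^ 2)

theorem driftFunctional_eq_log {u : ℝ} (F : PathSpace u → NNReal) (M : ℝ) (h g : H u) :
    driftFunctional F M h g = ENNReal.log (ENNReal.ofReal (expDrift F M h (density (g + h)))) := by
  have hJ : J u (density (g + h)) - h = (g : PathSpace u) := by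
    rw [J_density]
    simp
  rw [driftFunctional, logPayoff, expDrift, hJ, normH]
  -- When `F g = 0` both sides are `⊥`, since the remaining terms are finite.
  rcases eq_or_ne (F g) 0 with h0 | h0
  · simp [h0, EReal.mul_bot_of_pos]
  · have hpos : 0 < (F g : ℝ) := by positivity
    rw [ENNReal.log_ofReal_of_pos (by positivity), ENNReal.log_of_nnreal h0,
      Real.log_mul (by positivity) (Real.exp_ne_zero _), Real.log_exp, Real.log_pow]
    have h2 : (2 : EReal) = ((2 : ℝ) : EReal) := rfl
    rw [h2, ← EReal.coe_mul, ← EReal.coe_sub, ← EReal.coe_add, EReal.coe_eq_coe_iff]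
    push_cast
    ring

theorem expDrift_nonneg {u : ℝ} (F : PathSpace u → NNReal) (M : ℝ) (h : H u) (f : Lambda2 u) :
    0 ≤ expDrift F M h f := by
  unfold expDrift
  positivity

theorem continuous_expDrift {u : ℝ} {F : PathSpace u → NNReal} (hF : Continuous F) (M : ℝ)
    (h : H u) : Continuous (expDrift F M h) := by
  have := continuous_J u
  unfold expDrift
  fun_prop

theorem le_exp_of_logPayoff_le {u : ℝ} {F : PathSpace u → NNReal} {x : PathSpace u} {K : ℝ}
    (hK : logPayoff F x ≤ (K : EReal)) : (F x : ℝ) ≤ Real.exp K := by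
  rcases eq_or_ne (F x) 0 with h0 | h0
  · simp [h0, Real.exp_nonneg]
  · rw [logPayoff, ENNReal.log_of_nnreal h0, EReal.coe_le_coe_iff] at hK
    exact (Real.log_le_iff_le_exp (by positivity)).1 hK

/-- For `r ≥ 1`, `a r + c ≤ (a + c) r`; factoring out `r ^ α` leaves a factor tending to `-∞`
because `2 - α > 0`. -/
theorem tendsto_growth_sub_quadratic {A B a c α M : ℝ} (hB : 0 ≤ B) (ha : 0 ≤ a) (hc : 0 ≤ c)
    (hα₀ : 0 < α) (hα₂ : α < 2) (hM : 0 < M) :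
    Tendsto (fun r : ℝ => A + B * (a * r + c) ^ α - M * r ^ 2) atTop atBot := by
  have hlim : Tendsto (fun r : ℝ => r ^ α * (B * (a + c) ^ α - M * r ^ (2 - α))) atTop atBot := by
    refine (tendsto_rpow_atTop hα₀).atTop_mul_atBot₀ ?_
    have := (tendsto_rpow_atTop (sub_pos.2 hα₂)).const_mul_atTop hM
    simpa [sub_eq_add_neg] using tendsto_atBot_add_const_left atTop (B * (a + c) ^ α)
      (tendsto_neg_atTop_atBot.comp this)
  refine tendsto_atBot_mono' _ ?_ (tendsto_atBot_add_const_left atTop A hlim)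
  filter_upwards [eventually_ge_atTop (1 : ℝ)] with r hr
  have hr0 : 0 < r := by linarith
  have h1 : (a * r + c) ^ α ≤ (a + c) ^ α * r ^ α := by
    rw [← Real.mul_rpow (by positivity) hr0.le]
    refine Real.rpow_le_rpow (by positivity) ?_ hα₀.le
    nlinarith
  have h2 : r ^ α * r ^ (2 - α) = r ^ 2 := by
    rw [← Real.rpow_add hr0]
    norm_num
  have h3 := mul_le_mul_of_nonneg_left h1 hB
  calc _ ≤ A + B * ((a + c) ^ α * r ^ α) - M * r ^ 2 := by linarith
    _ = _ := by rw [← h2]; ring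

theorem expDrift_coercive {u : ℝ} {F : PathSpace u → NNReal} {K₁ K₂ α M : ℝ} (hK₂ : 0 < K₂)
    (hα₀ : 0 < α) (hα₂ : α < 2) (hM : 0 < M)
    (hgrowth : ∀ x : PathSpace u, logPayoff F x ≤ ((K₁ + K₂ * ‖x‖ ^ α : ℝ) : EReal))
    (h : H u) {ε : ℝ} (hε : 0 < ε) :
    ∃ R, ∀ f : Lambda2 u, R ≤ ‖f‖ → expDrift F M h f < ε := by
  have hlim := Real.tendsto_exp_atBot.comp (tendsto_growth_sub_quadratic
    (A := 2 * K₁ + normH h ^ 2) (B := 2 * K₂) (a := √((leb u).real univ))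
    (c := ‖(h : PathSpace u)‖) (by positivity) (by positivity) (norm_nonneg _) hα₀ hα₂ hM)
  obtain ⟨R, hR⟩ := eventually_atTop.1 (hlim.eventually (gt_mem_nhds hε))
  refine ⟨R, fun f hf => lt_of_le_of_lt ?_ (hR _ hf)⟩
  have hn : ‖J u f - h‖ ≤ √((leb u).real univ) * ‖f‖ + ‖(h : PathSpace u)‖ :=
    (norm_sub_le _ _).trans (add_le_add_left (norm_J_le f) _)
  have hF := le_exp_of_logPayoff_le (hgrowth (J u f - h))
  calc expDrift F M h f
      ≤ Real.exp (K₁ + K₂ * ‖J u f - h‖ ^ α) ^ 2 * Real.exp (normH h ^ 2 - M * ‖f‖ ^ 2) := by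
        unfold expDrift
        gcongr
    _ = Real.exp (2 * K₁ + normH h ^ 2 + 2 * K₂ * ‖J u f - h‖ ^ α - M * ‖f‖ ^ 2) := by
        rw [← Real.exp_nat_mul, ← Real.exp_add]
        congr 1
        push_cast
        ring
    _ ≤ _ := by
        simp only [Function.comp_apply]
        gcongr

/-! ### Weak compactness and existence of a maximizer -/

/-- The Riesz representative of a weakly-* continuous functional on `Λ²`. -/
noncomputable def riesz {u : ℝ} (φ : WeakDual ℝ (Lambda2 u)) : Lambda2 u :=
  (InnerProductSpace.toDual ℝ (Lambda2 u)).symm (WeakDual.toStrongDual φ)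

theorem inner_riesz {u : ℝ} (φ : WeakDual ℝ (Lambda2 u)) (v : Lambda2 u) :
    inner ℝ v (riesz φ) = φ v := by
  rw [real_inner_comm]
  exact InnerProductSpace.toDual_symm_apply

theorem exists_riesz_eq {u : ℝ} (f : Lambda2 u) : ∃ φ, riesz φ = f :=
  ⟨StrongDual.toWeakDual (InnerProductSpace.toDual ℝ (Lambda2 u) f),
    (InnerProductSpace.toDual ℝ (Lambda2 u)).symm_apply_apply f⟩

/-- Pairs of a functional and a bound `≤ R` on its norm. -/
def normBoundPairs (u R : ℝ) : Set (WeakDual ℝ (Lambda2 u) × ℝ) :=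
  {p | p.2 ∈ Icc 0 R ∧ ∀ v, |p.1 v| ≤ p.2 * ‖v‖}

theorem norm_riesz_le {u R : ℝ} {p : WeakDual ℝ (Lambda2 u) × ℝ} (hp : p ∈ normBoundPairs u R) :
    ‖riesz p.1‖ ≤ p.2 := by
  rw [riesz, LinearIsometryEquiv.norm_map]
  exact ContinuousLinearMap.opNorm_le_bound _ hp.1.1 hp.2

/-- The set is closed in the product of a Banach–Alaoglu ball and `[0, R]`: each `v` imposes a
weak-* closed condition. -/
theorem isCompact_normBoundPairs (u R : ℝ) : IsCompact (normBoundPairs u R) := by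
  refine ((WeakDual.isCompact_closedBall (0 : StrongDual ℝ (Lambda2 u)) R).prod
    (isCompact_Icc (a := (0 : ℝ)) (b := R))).of_isClosed_subset ?_ ?_
  · refine (isClosed_Icc.preimage continuous_snd).inter
      (s₂ := {p : WeakDual ℝ (Lambda2 u) × ℝ | ∀ v, |p.1 v| ≤ p.2 * ‖v‖}) ?_
    rw [Set.ofPred_forall]
    refine isClosed_iInter fun v => isClosed_le ?_ (by fun_prop)
    exact ((WeakDual.eval_continuous v).comp continuous_fst).abs
  · intro p hp
    refine ⟨?_, hp.1⟩
    simp only [mem_preimage, Metric.mem_closedBall, dist_zero_right]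
    exact (ContinuousLinearMap.opNorm_le_bound _ hp.1.1 hp.2).trans hp.1.2

/-- On norm-bounded sets, `J` is continuous from the weak topology to the supremum norm. -/
theorem continuousOn_J_riesz (u R : ℝ) :
    ContinuousOn (fun p : WeakDual ℝ (Lambda2 u) × ℝ => J u (riesz p.1)) (normBoundPairs u R) := by
  rw [continuousOn_iff_continuous_domRestrict]
  refine Continuous.subtype_mk (p := fun x => x ∈ PathSpace u)
    (f := fun q : normBoundPairs u R => (J u (riesz q.1.1) : C(Time u, ℝ))) ?_ _
  refine ContinuousMap.continuous_of_continuous_uncurry _ ?_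
  rw [continuous_iff_continuousAt]
  rintro ⟨q₀, t₀⟩
  -- Joint continuity in functional and time: the first term is at most `R` times a norm vanishing
  -- as `t → t₀`, uniformly in the functional; the second tests against a fixed vector.
  have heq : (Function.uncurry fun (q : normBoundPairs u R) (t : Time u) =>
      (J u (riesz q.1.1) : C(Time u, ℝ)) t) = fun z =>
      z.1.1.1 (initialIndicator z.2 - initialIndicator t₀) + z.1.1.1 (initialIndicator t₀) := by
    funext z
    rw [← map_add, sub_add_cancel, ← inner_riesz, inner_initialIndicator]
    rfl
  change ContinuousAt (Function.uncurry fun (q : normBoundPairs u R) (t : Time u) =>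
      (J u (riesz q.1.1) : C(Time u, ℝ)) t) _
  rw [heq]
  refine ContinuousAt.add ?_ ?_
  · rw [ContinuousAt, sub_self, map_zero]
    refine squeeze_zero_norm (a := fun z : normBoundPairs u R × Time u =>
      R * ‖initialIndicator z.2 - initialIndicator t₀‖) (fun z => ?_) ?_
    · exact (z.1.2.2 _).trans (mul_le_mul_of_nonneg_right z.1.2.1.2 (norm_nonneg _))
    · have hc : Continuous fun z : normBoundPairs u R × Time u =>
          R * ‖initialIndicator z.2 - initialIndicator t₀‖ := by
        have := continuous_initialIndicator u
        fun_prop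
      simpa using hc.tendsto (q₀, t₀)
  · exact ((WeakDual.eval_continuous (initialIndicator t₀)).comp (continuous_fst.comp
      (continuous_subtype_val.comp continuous_fst))).continuousAt

theorem exists_forall_expDrift_le {u : ℝ} {F : PathSpace u → NNReal} (hF : Continuous F)
    {K₁ K₂ α M : ℝ} (hK₂ : 0 < K₂) (hα₀ : 0 < α) (hα₂ : α < 2) (hM : 0 < M)
    (hgrowth : ∀ x : PathSpace u, logPayoff F x ≤ ((K₁ + K₂ * ‖x‖ ^ α : ℝ) : EReal))
    (h : H u) : ∃ f, ∀ f', expDrift F M h f' ≤ expDrift F M h f := by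
  -- If the functional vanishes identically every point is a maximizer; otherwise a positive value
  -- `expDrift F M h f₀` serves as the coercivity threshold.
  by_cases hzero : ∀ f, expDrift F M h f ≤ 0
  · exact ⟨0, fun f' => (hzero f').trans (expDrift_nonneg F M h 0)⟩
  push Not at hzero
  obtain ⟨f₀, hf₀⟩ := hzero
  obtain ⟨R, hR⟩ := expDrift_coercive hK₂ hα₀ hα₂ hM hgrowth h hf₀
  have hmem : ∀ f : Lambda2 u, ‖f‖ ≤ R → ∀ φ, riesz φ = f → (φ, ‖f‖) ∈ normBoundPairs u R := by
    rintro f hf φ rfl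
    refine ⟨⟨norm_nonneg _, hf⟩, fun v => ?_⟩
    change |φ v| ≤ ‖riesz φ‖ * ‖v‖
    rw [← inner_riesz, mul_comm]
    exact abs_real_inner_le_norm _ _
  have hlt : ∀ f, expDrift F M h f₀ ≤ expDrift F M h f → ‖f‖ ≤ R := fun f hf => by
    by_contra! hc
    exact absurd (hR f hc.le) (not_lt.2 hf)
  have hcont : ContinuousOn (fun p : WeakDual ℝ (Lambda2 u) × ℝ =>
      (F (J u (riesz p.1) - h) : ℝ) ^ 2 * Real.exp (normH h ^ 2 - M * p.2 ^ 2))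
      (normBoundPairs u R) := by
    refine ContinuousOn.mul ?_ (by fun_prop)
    exact ((NNReal.continuous_coe.comp hF).comp_continuousOn
      ((continuousOn_J_riesz u R).sub continuousOn_const)).pow 2
  obtain ⟨φ₀, hφ₀⟩ := exists_riesz_eq f₀
  obtain ⟨p, hp, hmax⟩ := (isCompact_normBoundPairs u R).exists_isMaxOn
    ⟨_, hmem f₀ (hlt f₀ le_rfl) φ₀ hφ₀⟩ hcont
  have hball : ∀ f, ‖f‖ ≤ R → expDrift F M h f ≤ expDrift F M h (riesz p.1) := by
    intro f hf
    obtain ⟨φ, rfl⟩ := exists_riesz_eq f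
    have hle := isMaxOn_iff.1 hmax _ (hmem _ hf φ rfl)
    unfold expDrift
    refine hle.trans ?_
    -- Lowering the bound `p.2` to the true norm reduces the penalty, as `M > 0`.
    have hsq := pow_le_pow_left₀ (norm_nonneg _) (norm_riesz_le hp) 2
    refine mul_le_mul_of_nonneg_left (Real.exp_le_exp.2 ?_) (by positivity)
    linarith [mul_le_mul_of_nonneg_left hsq hM.le]
  refine ⟨riesz p.1, fun f => ?_⟩
  rcases le_total (expDrift F M h f₀) (expDrift F M h f) with h1 | h1
  · exact hball f (hlt f h1)
  · exact h1.trans (hball f₀ (hlt f₀ le_rfl))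

end CameronMartin

/-! ### Density of networks in `Λ²` -/

namespace CameronMartin

/-- Pairing with `f` vanishes on polynomials, hence on continuous functions by Weierstrass, hence on
`Λ²`, where continuous functions are dense. -/
theorem eq_zero_of_integral_mul_pow_eq_zero {u : ℝ} (f : Lambda2 u)
    (h0 : ∀ k : ℕ, ∫ t, f t * (t : ℝ) ^ k ∂leb u = 0) : f = 0 := by
  let L : C(Time u, ℝ) →L[ℝ] ℝ := (innerSL ℝ f).comp (ContinuousMap.toLp 2 (leb u) ℝ)
  have hL : ∀ g : C(Time u, ℝ), L g = ∫ t, f t * g t ∂leb u := by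
    intro g
    change inner ℝ f (ContinuousMap.toLp 2 (leb u) ℝ g) = _
    rw [L2.inner_def]
    refine integral_congr_ae ?_
    filter_upwards [ContinuousMap.coeFn_toLp (p := 2) (𝕜 := ℝ) (leb u) g] with t ht
    rw [ht]
    simp [mul_comm]
  have hpoly : ∀ P : Polynomial ℝ, L (P.toContinuousMapOn (Icc 0 u)) = 0 := by
    intro P
    induction P using Polynomial.induction_on' with
    | add p q hp hq =>
      have hadd : (p + q).toContinuousMapOn (Icc 0 u)
          = p.toContinuousMapOn (Icc 0 u) + q.toContinuousMapOn (Icc 0 u) := by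
        ext t
        simp
      rw [hadd, map_add, hp, hq, add_zero]
    | monomial n a =>
      rw [hL]
      have : ∀ t : Time u, f t * ((Polynomial.monomial n a).toContinuousMapOn (Icc 0 u)) t
          = a * (f t * (t : ℝ) ^ n) := fun t => by
        simp
        ring
      simp only [this]
      rw [integral_const_mul, h0, mul_zero]
  have hzero : ∀ g, L g = 0 := by
    intro g
    have hg : g ∈ closure (polynomialFunctions (Icc 0 u) : Set C(Time u, ℝ)) := by
      rw [← Subalgebra.topologicalClosure_coe, polynomialFunctions_closure_eq_top]
      trivial
    refine closure_minimal (t := {g | L g = 0}) ?_ (isClosed_eq L.continuous continuous_const) hg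
    rintro _ ⟨P, -, rfl⟩
    exact hpoly P
  have hinner : ∀ v : Lambda2 u, inner ℝ f v = 0 := by
    refine congrFun ((ContinuousMap.toLp_denseRange ℝ (leb u) ℝ (p := 2) (by simp)).equalizer
      (by fun_prop) continuous_const (funext hzero))
  exact inner_self_eq_zero.1 (hinner f)

/-- Classes in `Λ²` of shallow networks. -/
noncomputable def networkClasses (u : ℝ) (ψ : ℝ → ℝ) : Submodule ℝ (Lambda2 u) where
  carrier := {f | ∃ φ ∈ NN u ψ, f =ᵐ[leb u] φ}
  add_mem' := by
    rintro f g ⟨φ, hφ, hf⟩ ⟨χ, hχ, hg⟩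
    exact ⟨φ + χ, add_mem hφ hχ, (Lp.coeFn_add f g).trans (hf.add hg)⟩
  zero_mem' := ⟨0, zero_mem _, Lp.coeFn_zero _ _ _⟩
  smul_mem' := by
    rintro c f ⟨φ, hφ, hf⟩
    exact ⟨c • φ, Submodule.smul_mem _ c hφ, (Lp.coeFn_smul c f).trans (hf.const_smul c)⟩

theorem topologicalClosure_networkClasses (u : ℝ) {ψ : ℝ → ℝ} (hψ : Continuous ψ)
    (hb : ∃ C, ∀ x, |ψ x| ≤ C) (hnc : ¬ ∃ c, ∀ x, ψ x = c) :
    (networkClasses u ψ).topologicalClosure = ⊤ := by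
  rw [Submodule.topologicalClosure_eq_top_iff, Submodule.eq_bot_iff]
  intro f hf
  refine eq_zero_of_integral_mul_pow_eq_zero f fun k =>
    integral_mul_pow_eq_zero_of_ridge (τ := ((↑) : Time u → ℝ)) measurable_subtype_coe (r := u)
      (fun t => by rw [abs_of_nonneg t.2.1]; exact t.2.2) (integrable_lambda2 f) hψ hb hnc
      (fun a b => ?_) k
  let g : C(Time u, ℝ) := ⟨fun t => ψ (a * t + b), by fun_prop⟩
  have hg := ContinuousMap.coeFn_toLp (p := 2) (𝕜 := ℝ) (leb u) g
  have hmem : ContinuousMap.toLp 2 (leb u) ℝ g ∈ networkClasses u ψ :=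
    ⟨_, Submodule.subset_span ⟨a, b, rfl⟩, hg⟩
  refine Eq.trans ?_ ((Submodule.mem_orthogonal _ f).1 hf _ hmem)
  rw [L2.inner_def]
  refine integral_congr_ae ?_
  filter_upwards [hg] with t ht
  rw [ht]
  rfl

theorem exists_seq_HOf_NN_tendsto {u : ℝ} {ψ : ℝ → ℝ} (hψ : Continuous ψ)
    (hb : ∃ C, ∀ x, |ψ x| ≤ C) (hnc : ¬ ∃ c, ∀ x, ψ x = c) (g : H u) :
    ∃ hn : ℕ → H u, (∀ n, hn n ∈ HOf (NN u ψ : Set (Time u → ℝ))) ∧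
      Tendsto (fun n => density (hn n)) atTop (𝓝 (density g)) := by
  have hg : density g ∈ closure (networkClasses u ψ : Set (Lambda2 u)) := by
    rw [← Submodule.topologicalClosure_coe, topologicalClosure_networkClasses u hψ hb hnc]
    trivial
  obtain ⟨f, hf, hlim⟩ := mem_closure_iff_seq_limit.1 hg
  refine ⟨fun n => ofDensity (f n), fun n => ?_, by simpa only [density_ofDensity] using hlim⟩
  obtain ⟨φ, hφ, hae⟩ := hf n
  exact ⟨φ, hφ, by rwa [density_ofDensity]⟩

end CameronMartin

theorem mainTheorem9 (u : ℝ) (hu : 0 < u)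
    (ψ : ℝ → ℝ) (hψ : ContDiff ℝ 1 ψ) (hψ_bdd : ∃ C : ℝ, ∀ x, |ψ x| ≤ C)
    (hψ_nonconst : ¬ ∃ c : ℝ, ∀ x, ψ x = c)
    (F : CameronMartin.PathSpace u → NNReal) (hF : Continuous F)
    (K₁ K₂ α : ℝ) (hK₁ : 0 < K₁) (hK₂ : 0 < K₂) (hα₀ : 0 < α) (hα₂ : α < 2)
    (hgrowth : ∀ x : CameronMartin.PathSpace u,
      CameronMartin.logPayoff F x ≤ ((K₁ + K₂ * ‖x‖ ^ α : ℝ) : EReal)) :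
    CameronMartin.HOf (CameronMartin.NN u ψ : Set (CameronMartin.Time u → ℝ))
        ⊆ CameronMartin.Hbv u ∧
    ∀ (M : ℝ), 0 < M → ∀ h : CameronMartin.H u,
      (∃ g : CameronMartin.H u,
        IsGreatest (Set.range (CameronMartin.driftFunctional F M h))
          (CameronMartin.driftFunctional F M h g)) ∧
      ∀ g : CameronMartin.H u,
        IsGreatest (Set.range (CameronMartin.driftFunctional F M h))
          (CameronMartin.driftFunctional F M h g) →
        ∃ hn : ℕ → CameronMartin.H u,
          (∀ n, hn n ∈
            CameronMartin.HOf (CameronMartin.NN u ψ : Set (CameronMartin.Time u → ℝ))) ∧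
          Tendsto (fun n => CameronMartin.driftFunctional F M h (hn n)) atTop
            (𝓝 (CameronMartin.driftFunctional F M h g)) := by
  refine ⟨CameronMartin.HOf_NN_subset_Hbv hψ, fun M hM h => ⟨?_, fun g _ => ?_⟩⟩
  · obtain ⟨f, hf⟩ := CameronMartin.exists_forall_expDrift_le hF hK₂ hα₀ hα₂ hM hgrowth h
    -- `expDrift` takes the density of `g + h`, so that of `h` is subtracted from the maximizer.
    refine ⟨CameronMartin.ofDensity (f - CameronMartin.density h), mem_range_self _, ?_⟩
    rintro _ ⟨g, rfl⟩
    rw [CameronMartin.driftFunctional_eq_log, CameronMartin.driftFunctional_eq_log,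
      CameronMartin.density_add (CameronMartin.ofDensity _), CameronMartin.density_ofDensity,
      sub_add_cancel]
    exact ENNReal.log_monotone (ENNReal.ofReal_le_ofReal (hf _))
  · obtain ⟨hn, hmem, hlim⟩ :=
      CameronMartin.exists_seq_HOf_NN_tendsto hψ.continuous hψ_bdd hψ_nonconst g
    refine ⟨hn, hmem, ?_⟩
    simp only [CameronMartin.driftFunctional_eq_log, CameronMartin.density_add]
    -- The extended logarithm is continuous also at `0`, so a limit value `-∞` needs no separate
    -- case.
    exact ((ENNReal.continuous_log.comp ENNReal.continuous_ofReal).comp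
      (CameronMartin.continuous_expDrift hF M h)).continuousAt.tendsto.comp
      (hlim.add_const (CameronMartin.density h))
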